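/- Let $X_1, X_2, \dots$ be independent and identically distributed real random variables on a probability space $(\Omega,\mathcal F,\mathsf P)$ with $\mathsf E|X_1|<\infty$ and $\mathsf E[X_1]=0$, and let $S_k := \sum_{i=1}^k X_i$. Let $\bar\sigma\in(0,\infty)$ and assume that $X_1$ has finite variance $\sigma^2 := \mathrm{Var}[X_1] \le \bar\sigma^2$. For $x\ge 0$ put $$\bar{\mathsf U}^{(2)}(x) := \mathsf E\left[\,|X_1^2-\sigma^2|\,\mathbf 1\{|X_1^2-\sigma^2|\ge x\}\right].$$ For $\varepsilon>0$ put $$c_\varepsilon := \frac{(1+\varepsilon)^{5/4}+(1+\varepsilon)^{3/4}}{\sqrt2},\qquad \ell_\varepsilon := \log\left(\frac{2\zeta(1+\varepsilon)}{\log(1+\varepsilon)}\right),$$ where $\zeta(z)=\sum_{j=1}^\infty j^{-z}$, $z>1$, is the Riemann zeta function. Then for all $\varepsilon>0$, $\lambda\in(0,1/2)$ and every integer $m\ge 2$, $$\mathsf P\left[\sup_{k\ge m}\frac{|S_k/\bar\sigma|}{c_\varepsilon\sqrt{k\left(\log\log((1+\varepsilon)^2k)+\ell_\varepsilon\right)}}\ge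 1\right]\le \frac{\left(\log_{1+\varepsilon}(2m/3)\right)^{-\varepsilon}}{\varepsilon\,\zeta(1+\varepsilon)}+\frac{262}{\min(\varepsilon^2\bar\sigma^4,\,1)}\left(m^{2\lambda-1}+\bar{\mathsf U}^{(2)}(m^\lambda)\right).$$ -/

import Mathlib

open MeasureTheory ProbabilityTheory

namespace LILInequality

noncomputable section

/-- The Riemann zeta function at a real argument `s > 1`: `ζ(s) = ∑_{j ≥ 1} j^{-s}`. -/
def zeta (s : ℝ) : ℝ := ∑' j : ℕ, ((j : ℝ) + 1) ^ (-s)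

/-- For real `s > 1`, `zeta s` is the value at `s` of Mathlib's Riemann zeta function. -/
theorem ofReal_zeta {s : ℝ} (hs : 1 < s) : ((zeta s : ℝ) : ℂ) = riemannZeta (s : ℂ) := by
  rw [zeta_eq_tsum_one_div_nat_add_one_cpow (by simpa using hs), zeta, Complex.ofReal_tsum]
  refine tsum_congr fun j => ?_
  have hj : (0 : ℝ) ≤ (j : ℝ) + 1 := by positivity
  rw [Complex.ofReal_cpow hj]
  push_cast
  rw [Complex.cpow_neg, one_div]

/-- `c_ε = ((1+ε)^{5/4} + (1+ε)^{3/4}) / √2`. -/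
def cConst (ε : ℝ) : ℝ :=
  ((1 + ε) ^ (5 / 4 : ℝ) + (1 + ε) ^ (3 / 4 : ℝ)) / Real.sqrt 2

/-- `ℓ_ε = log (2 ζ(1+ε) / log (1+ε))`. -/
def lConst (ε : ℝ) : ℝ :=
  Real.log (2 * zeta (1 + ε) / Real.log (1 + ε))

variable {Ω : Type*}

/-- The partial sum of the first `k` variables; the sequence is indexed from `0`, so that
`X 0, X 1, …` are `X_1, X_2, …` in the usual numbering. -/
def partialSum (X : ℕ → Ω → ℝ) (k : ℕ) (ω : Ω) : ℝ :=
  ∑ i ∈ Finset.range k, X i ω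

/-- The truncated first absolute moment `E[|Y² - σ²| 1{|Y² - σ²| ≥ x}]`, where `σ² = Var Y`. -/
def truncMoment [MeasurableSpace Ω] (P : Measure Ω) (Y : Ω → ℝ) (x : ℝ) : ℝ :=
  ∫ ω, Set.indicator {ω' | x ≤ |Y ω' ^ 2 - variance Y P|}
    (fun ω' => |Y ω' ^ 2 - variance Y P|) ω ∂P

end

end LILInequality

/-! Write `ξ i = X i / σ` and `W k = ∑ (ξ i ^ 2 + 2) / 3`. Because `exp (x - x²/6) ≤ 1 + x + x²/3`,
the factors of `exp (θ S k - θ² W k / 2)` have mean at most one for every real `θ`, with only a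
second moment assumed. Ville's inequality then gives linear boundaries for `S` in terms of `W`.
Stitching them over geometric epochs of `W`, one slope per epoch and sign, gives the
iterated-logarithm boundary, with the zeta term as total error (`measure_exists_boundary_le`).

Stitching needs `W k ≤ (1 + ε) k`. If this fails, the centred squares `X i ^ 2 - v`, with `v` the
variance of `X 0`, have sum at least `3 ε σ² k`. A quantitative strong law
(`measure_exists_sum_ge`), proved by truncation, Kolmogorov's inequality and Abel summation, makes
this unlikely for all `k ≥ m` at once.

These two facts bound the probability that some `k ≥ m` reaches the boundary. A supremum can also
equal one without being attained, but then the ratio comes arbitrarily close to one for infinitely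
many `k`. The crossing bound for `ε / 2`, whose boundary is eventually a fixed factor smaller, makes
that a null event. -/

namespace LILInequality

/-! ### Maximal inequalities over an infinite horizon -/

section Maximal

variable {Ω : Type*} [mΩ : MeasurableSpace Ω] {μ : Measure Ω}

/-- Doob's maximal inequality over an infinite horizon. -/
theorem measure_exists_le_of_submartingale [IsFiniteMeasure μ] {𝒢 : Filtration ℕ mΩ}
    {f : ℕ → Ω → ℝ} (hf : Submartingale f 𝒢 μ) (hnonneg : 0 ≤ f) {C c : ℝ} (hc : 0 < c)
    (hC : ∀ n, ∫ ω, f n ω ∂μ ≤ C) :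
    μ {ω | ∃ n, c ≤ f n ω} ≤ ENNReal.ofReal (C / c) := by
  have hU : {ω | ∃ n, c ≤ f n ω} = ⋃ n : ℕ, {ω | ∃ k ≤ n, c ≤ f k ω} := by
    ext ω
    simp only [Set.mem_ofPred_eq, Set.mem_iUnion]
    exact ⟨fun ⟨n, hn⟩ => ⟨n, n, le_rfl, hn⟩, fun ⟨_, k, _, hk⟩ => ⟨k, hk⟩⟩
  have hmono : Monotone fun n : ℕ => {ω | ∃ k ≤ n, c ≤ f k ω} :=
    fun a b hab ω ⟨k, hk, h⟩ => ⟨k, hk.trans hab, h⟩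
  rw [hU, hmono.measure_iUnion]
  refine iSup_le fun n => ?_
  lift c to NNReal using hc.le
  have key := maximal_ineq hf hnonneg (ε := c) n
  have hset : {ω | (c : ℝ) ≤
      (Finset.range (n + 1)).sup' Finset.nonempty_range_add_one fun k => f k ω}
      = {ω | ∃ k ≤ n, (c : ℝ) ≤ f k ω} := by
    ext ω
    simp [Finset.le_sup'_iff]
  rw [hset] at key
  have hle : ∫ ω in {ω | ∃ k ≤ n, (c : ℝ) ≤ f k ω}, f n ω ∂μ ≤ C :=
    (setIntegral_le_integral (hf.integrable n)
      (Filter.Eventually.of_forall (hnonneg n))).trans (hC n)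
  rw [ENNReal.ofReal_div_of_pos hc, ENNReal.ofReal_coe_nnreal,
    ENNReal.le_div_iff_mul_le (Or.inl (by exact_mod_cast hc.ne')) (by simp), mul_comm]
  exact key.trans (ENNReal.ofReal_le_ofReal hle)

theorem martingale_sum_range_succ {f : ℕ → Ω → ℝ}
    (hf : ∀ i, StronglyMeasurable (f i)) (hind : iIndepFun f μ) (hint : ∀ i, Integrable (f i) μ)
    (hmean : ∀ i, ∫ ω, f i ω ∂μ = 0) :
    Martingale (fun n ω => ∑ i ∈ Finset.range (n + 1), f i ω) (Filtration.natural f hf) μ := by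
  have : IsProbabilityMeasure μ := hind.isProbabilityMeasure
  refine martingale_of_condExp_sub_eq_zero_nat ?_ (fun n => integrable_finsetSum _ fun i _ => hint i)
    fun n => ?_
  · intro n
    refine Finset.stronglyMeasurable_fun_sum _ fun i hi => ?_
    exact (Filtration.stronglyAdapted_natural hf i).mono
      ((Filtration.natural f hf).mono (Nat.lt_succ_iff.1 (Finset.mem_range.1 hi)))
  · have h1 : ((fun ω => ∑ i ∈ Finset.range (n + 1 + 1), f i ω) -
        fun ω => ∑ i ∈ Finset.range (n + 1), f i ω) = f (n + 1) := by
      ext ω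
      simp [Finset.sum_range_succ]
    rw [h1]
    filter_upwards [hind.condExp_natural_ae_eq_of_lt hf (Nat.lt_succ_self n)] with ω hω
    rw [hω, hmean]; rfl

theorem martingale_prod_range_succ {f : ℕ → Ω → ℝ}
    (hf : ∀ i, StronglyMeasurable (f i)) (hind : iIndepFun f μ) (hint : ∀ i, Integrable (f i) μ)
    (hmean : ∀ i, ∫ ω, f i ω ∂μ = 1) :
    Martingale (fun n ω => ∏ i ∈ Finset.range (n + 1), f i ω) (Filtration.natural f hf) μ := by
  have : IsProbabilityMeasure μ := hind.isProbabilityMeasure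
  have hadp : StronglyAdapted (Filtration.natural f hf)
      (fun n ω => ∏ i ∈ Finset.range (n + 1), f i ω) := by
    intro n
    refine Finset.stronglyMeasurable_fun_prod _ fun i hi => ?_
    exact (Filtration.stronglyAdapted_natural hf i).mono
      ((Filtration.natural f hf).mono (Nat.lt_succ_iff.1 (Finset.mem_range.1 hi)))
  have hI : ∀ n, Integrable (fun ω => ∏ i ∈ Finset.range (n + 1), f i ω) μ := by
    intro n
    induction n with
    | zero => simpa using hint 0
    | succ n ih =>
      simp_rw [Finset.prod_range_succ _ (n + 1)]
      refine IndepFun.integrable_mul ?_ ih (hint _)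
      have := hind.indepFun_prod_range_succ (fun i => (hf i).measurable) (n + 1)
      convert this using 1
      ext ω
      simp
  refine martingale_nat hadp hI fun n => ?_
  have h1 : (fun ω => ∏ i ∈ Finset.range (n + 1 + 1), f i ω) =
      (fun ω => ∏ i ∈ Finset.range (n + 1), f i ω) * f (n + 1) := by
    ext ω
    simp [Finset.prod_range_succ]
  have h2 := condExp_mul_of_stronglyMeasurable_left (μ := μ) (hadp n)
    (h1 ▸ hI (n + 1)) (hint (n + 1))
  rw [h1]
  filter_upwards [hind.condExp_natural_ae_eq_of_lt hf (Nat.lt_succ_self n), h2] with ω hω h3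
  rw [h3, Pi.mul_apply, hω, hmean, mul_one]

/-- Ville's inequality for products of independent nonnegative variables of mean at most one. -/
theorem measure_exists_le_prod {f : ℕ → Ω → ℝ} (hf : ∀ i, StronglyMeasurable (f i))
    (hind : iIndepFun f μ) (hint : ∀ i, Integrable (f i) μ) (hnonneg : ∀ i ω, 0 ≤ f i ω)
    (hmean : ∀ i, ∫ ω, f i ω ∂μ ≤ 1) {c : ℝ} (hc : 0 < c) :
    μ {ω | ∃ n, c ≤ ∏ i ∈ Finset.range (n + 1), f i ω} ≤ ENNReal.ofReal (1 / c) := by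
  have : IsProbabilityMeasure μ := hind.isProbabilityMeasure
  -- Adding the nonnegative defect `1 - E f i` makes every mean exactly one: the product becomes a
  -- martingale and dominates the original one.
  set g : ℕ → Ω → ℝ := fun i ω => f i ω + (1 - ∫ ω, f i ω ∂μ) with hg
  have hgm : ∀ i, StronglyMeasurable (g i) := fun i => (hf i).add stronglyMeasurable_const
  have hgind : iIndepFun g μ :=
    hind.comp (fun i x => x + (1 - ∫ ω, f i ω ∂μ)) fun i => measurable_id.add_const _
  have hfg : ∀ i ω, f i ω ≤ g i ω := fun i ω => by
    have := hmean i
    simp only [hg]; linarith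
  have hmart := martingale_prod_range_succ hgm hgind
    (fun i => (hint i).add (integrable_const _)) fun i => by
      simp only [hg]
      rw [integral_add (hint i) (integrable_const _)]
      simp
  refine (measure_mono ?_).trans (measure_exists_le_of_submartingale hmart.submartingale
    (fun n ω => Finset.prod_nonneg fun i _ => (hnonneg i ω).trans (hfg i ω)) (C := 1) hc ?_)
  · rintro ω ⟨n, hn⟩
    exact ⟨n, hn.trans (Finset.prod_le_prod (fun i _ => hnonneg i ω) fun i _ => hfg i ω)⟩
  · intro n
    have h0 : ∫ ω, ∏ i ∈ Finset.range (0 + 1), g i ω ∂μ = 1 := by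
      simp only [zero_add, Finset.range_one, Finset.prod_singleton, hg]
      rw [integral_add (hint 0) (integrable_const _)]
      simp
    have := hmart.setIntegral_eq n.zero_le MeasurableSet.univ
    simp only [Measure.restrict_univ] at this
    rw [← this, h0]

/-- Kolmogorov's maximal inequality over an infinite horizon. -/
theorem measure_exists_le_abs_sum {f : ℕ → Ω → ℝ} (hf : ∀ i, StronglyMeasurable (f i))
    (hind : iIndepFun f μ) (hL2 : ∀ i, MemLp (f i) 2 μ) (hmean : ∀ i, ∫ ω, f i ω ∂μ = 0)
    {b C : ℝ} (hb : 0 < b) (hC : ∀ n, ∑ i ∈ Finset.range n, ∫ ω, f i ω ^ 2 ∂μ ≤ C) :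
    μ {ω | ∃ n, b ≤ |∑ i ∈ Finset.range n, f i ω|} ≤ ENNReal.ofReal (C / b ^ 2) := by
  have : IsProbabilityMeasure μ := hind.isProbabilityMeasure
  have hint : ∀ i, Integrable (f i) μ := fun i => (hL2 i).integrable one_le_two
  have hmart := martingale_sum_range_succ hf hind hint hmean
  have hSL2 : ∀ n, MemLp (fun ω => ∑ i ∈ Finset.range n, f i ω) 2 μ :=
    fun n => memLp_finsetSum _ fun i _ => hL2 i
  have hsub : Submartingale (fun n ω => (∑ i ∈ Finset.range (n + 1), f i ω) ^ 2)
      (Filtration.natural f hf) μ := by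
    refine submartingale_nat (fun n => (hmart.stronglyAdapted n).pow 2)
      (fun n => (hSL2 (n + 1)).integrable_sq) fun n => ?_
    have hj := (even_two.convexOn_pow (𝕜 := ℝ)).map_condExp_le_univ
      (m := Filtration.natural f hf n) ((Filtration.natural f hf).le n)
      (continuous_pow 2).lowerSemicontinuous
      (hmart.integrable (n + 1)) (hSL2 (n + 2)).integrable_sq
    filter_upwards [hj, hmart.condExp_ae_eq n.le_succ] with ω h1 h2
    rw [← h2]
    exact h1
  have hvar : ∀ n, ∫ ω, (∑ i ∈ Finset.range n, f i ω) ^ 2 ∂μ ≤ C := by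
    intro n
    refine le_trans (le_of_eq ?_) (hC n)
    have h1 := IndepFun.variance_sum (s := Finset.range n) (fun i _ => hL2 i)
      (fun i _ j _ hij => hind.indepFun hij)
    rw [variance_of_integral_eq_zero (by fun_prop) ?_] at h1
    · simp only [Finset.sum_apply] at h1
      rw [h1]
      exact Finset.sum_congr rfl fun i _ =>
        variance_of_integral_eq_zero (hf i).measurable.aemeasurable (hmean i)
    · simp only [Finset.sum_apply]
      rw [integral_finsetSum _ fun i _ => hint i]
      simp [hmean]
  refine (measure_mono ?_).trans (measure_exists_le_of_submartingale hsub
    (fun n ω => sq_nonneg _) (pow_pos hb 2) fun n => hvar (n + 1))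
  rintro ω ⟨n, hn⟩
  cases n with
  | zero => simp at hn; linarith
  | succ n => exact ⟨n, by rw [← sq_abs (∑ i ∈ _, _)]; gcongr⟩

end Maximal

/-! ### Truncation and a quantitative strong law of large numbers -/

/-- The truncation of `z` at level `L`. -/
noncomputable def trunc (L z : ℝ) : ℝ := if |z| < L then z else 0

/-- The part of `|z|` above the level `x`. -/
noncomputable def tailPart (x z : ℝ) : ℝ := if x ≤ |z| then |z| else 0

theorem measurable_trunc (L : ℝ) : Measurable (trunc L) :=
  Measurable.ite (measurableSet_lt measurable_norm measurable_const) measurable_id measurable_const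

theorem measurable_tailPart (x : ℝ) : Measurable (tailPart x) :=
  Measurable.ite (measurableSet_le measurable_const measurable_norm) measurable_norm
    measurable_const

theorem tailPart_nonneg (x z : ℝ) : 0 ≤ tailPart x z := by
  unfold tailPart; split_ifs <;> positivity

theorem tailPart_le_abs (x z : ℝ) : tailPart x z ≤ |z| := by
  unfold tailPart; split_ifs
  · exact le_rfl
  · positivity

theorem abs_trunc_le_abs (L z : ℝ) : |trunc L z| ≤ |z| := by
  unfold trunc; split_ifs <;> simp

theorem abs_trunc_le {L : ℝ} (hL : 0 ≤ L) (z : ℝ) : |trunc L z| ≤ L := by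
  unfold trunc; split_ifs with h
  · exact h.le
  · simpa using hL

theorem trunc_sub_le_tailPart {x L : ℝ} (hxL : x ≤ L) (z : ℝ) : trunc L z - z ≤ tailPart x z := by
  unfold trunc
  split_ifs with h
  · simpa using tailPart_nonneg x z
  · rw [tailPart, if_pos (hxL.trans (not_lt.1 h))]
    linarith [neg_abs_le z]

/-- The first `m` terms equal `1 / (m + z)²` and contribute at most `1 / (m + z)`; the later ones
telescope through `1 / (a + 1)² ≤ 1 / a - 1 / (a + 1)`. -/
theorem sum_inv_sq_max_add_le {m : ℕ} (hm : 1 ≤ m) {z : ℝ} (hz : 0 ≤ z) (n : ℕ) :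
    ∑ i ∈ Finset.range n, 1 / (max ((i : ℝ) + 1) m + z) ^ 2 ≤ 2 / (m + z) := by
  have hm' : (1 : ℝ) ≤ m := by exact_mod_cast hm
  have hsmall : ∀ n ≤ m, ∑ i ∈ Finset.range n, 1 / (max ((i : ℝ) + 1) m + z) ^ 2
      ≤ 1 / (m + z) := by
    intro n hn
    have hn' : (n : ℝ) ≤ m := by exact_mod_cast hn
    calc ∑ i ∈ Finset.range n, 1 / (max ((i : ℝ) + 1) m + z) ^ 2
        ≤ ∑ i ∈ Finset.range n, 1 / ((m : ℝ) + z) ^ 2 := by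
          refine Finset.sum_le_sum fun i _ => ?_
          gcongr
          exact le_max_right _ _
      _ = n / ((m : ℝ) + z) ^ 2 := by simp [div_eq_mul_inv]
      _ ≤ (m + z) / ((m : ℝ) + z) ^ 2 := by gcongr; linarith
      _ = 1 / (m + z) := by field_simp
  have hlarge : ∀ n, m ≤ n → ∑ i ∈ Finset.range n, 1 / (max ((i : ℝ) + 1) m + z) ^ 2
      ≤ 2 / (m + z) - 1 / (n + z) := by
    intro n hn
    induction n, hn using Nat.le_induction with
    | base =>
      refine (hsmall m le_rfl).trans (le_of_eq ?_)
      field_simp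
      ring
    | succ n hn ih =>
      have hn' : (m : ℝ) ≤ n := by exact_mod_cast hn
      rw [Finset.sum_range_succ, max_eq_left (by linarith)]
      have h1 : 0 < (n : ℝ) + z := by linarith
      have h2 : 1 / ((n : ℝ) + 1 + z) ^ 2 ≤ 1 / (n + z) - 1 / (n + 1 + z) := by
        rw [div_sub_div _ _ h1.ne' (by positivity), div_le_div_iff₀ (by positivity) (by positivity)]
        nlinarith
      push_cast
      linarith
  rcases le_total n m with h | h
  · refine (hsmall n h).trans ?_
    gcongr
    norm_num
  · refine (hlarge n h).trans ?_
    have : 0 ≤ 1 / ((n : ℝ) + z) := by positivity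
    linarith

/-- Where `|z| < L`, `1 / L ≤ 2 / (L + |z|)`, which removes the cutoff and bounds the sum by `8 z² /
(m + |z|)`. This is at most `8 |z|` when `|z| ≥ x` and at most `8 x² / m` otherwise. -/
theorem sum_trunc_sq_div_le {m : ℕ} (hm : 1 ≤ m) {x : ℝ} (z : ℝ) (n : ℕ) :
    ∑ i ∈ Finset.range n, trunc (max ((i : ℝ) + 1) m) z ^ 2 / max ((i : ℝ) + 1) m ^ 2
      ≤ 8 * (x ^ 2 / m + tailPart x z) := by
  have hm' : (1 : ℝ) ≤ m := by exact_mod_cast hm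
  have hz := abs_nonneg z
  have h1 : ∑ i ∈ Finset.range n, trunc (max ((i : ℝ) + 1) m) z ^ 2 / max ((i : ℝ) + 1) m ^ 2
      ≤ 4 * z ^ 2 * ∑ i ∈ Finset.range n, 1 / (max ((i : ℝ) + 1) m + |z|) ^ 2 := by
    rw [Finset.mul_sum]
    refine Finset.sum_le_sum fun i _ => ?_
    have hL : (1 : ℝ) ≤ max ((i : ℝ) + 1) m := hm'.trans (le_max_right _ _)
    unfold trunc
    split_ifs with h
    · rw [mul_one_div, div_le_div_iff₀ (by positivity) (by positivity)]
      have : (max ((i : ℝ) + 1) m + |z|) ^ 2 ≤ (2 * max ((i : ℝ) + 1) m) ^ 2 := by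
        gcongr; linarith
      nlinarith [sq_nonneg z]
    · simp only [ne_eq, OfNat.ofNat_ne_zero, not_false_eq_true, zero_pow, zero_div]
      positivity
  refine h1.trans ((mul_le_mul_of_nonneg_left (sum_inv_sq_max_add_le hm hz n)
    (by positivity)).trans ?_)
  rw [mul_div_assoc', div_le_iff₀ (by positivity)]
  unfold tailPart
  split_ifs with h
  · have h2 : 0 ≤ x ^ 2 / m := by positivity
    have h3 : z ^ 2 = |z| * |z| := by rw [← sq, sq_abs]
    nlinarith [mul_nonneg hz (by linarith : (0 : ℝ) ≤ m), mul_nonneg h2 hz]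
  · have h3 : z ^ 2 ≤ x ^ 2 := by
      rw [← sq_abs z]; gcongr; exact (not_le.1 h).le
    have h4 : x ^ 2 / m * m = x ^ 2 := by field_simp
    have h2 : 0 ≤ x ^ 2 / m := by positivity
    nlinarith [mul_nonneg h2 hz]

/-- The sum counts indices with `i + 1 ≤ |z|`, at most `⌊|z|⌋`, and vanishes when `|z| < m`. -/
theorem sum_indicator_max_le_tailPart {m : ℕ} {x : ℝ} (hx : x ≤ m) (z : ℝ) (n : ℕ) :
    ∑ i ∈ Finset.range n, (if max ((i : ℝ) + 1) m ≤ |z| then (1 : ℝ) else 0) ≤ tailPart x z := by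
  by_cases h : (m : ℝ) ≤ |z|
  · rw [tailPart, if_pos (hx.trans h), ← Finset.sum_filter, Finset.sum_const, nsmul_eq_mul, mul_one]
    have hsub : (Finset.range n).filter (fun i : ℕ => max ((i : ℝ) + 1) m ≤ |z|)
        ⊆ Finset.range ⌊|z|⌋₊ := by
      intro i hi
      simp only [Finset.mem_filter, max_le_iff] at hi
      rw [Finset.mem_range, Nat.lt_iff_add_one_le, Nat.le_floor_iff (abs_nonneg z)]
      exact_mod_cast hi.2.1
    have := Finset.card_le_card hsub
    rw [Finset.card_range] at this
    exact (by exact_mod_cast this : _ ≤ ((⌊|z|⌋₊ : ℕ) : ℝ)).trans (Nat.floor_le (abs_nonneg z))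
  · refine (Finset.sum_nonpos fun i _ => ?_).trans (tailPart_nonneg x z)
    rw [if_neg]
    exact fun h' => h ((le_max_right _ _).trans h')

/-- A quantitative Kronecker lemma: Abel summation recovers the plain sums from the weighted ones.
The weight is constant up to `m`, so the increments cost `(k - m) b` and the boundary term less than
`k b`. -/
theorem abs_sum_lt_of_weighted {m : ℕ} (hm : 1 ≤ m) {a : ℕ → ℝ} {b : ℝ}
    (hT : ∀ k, |∑ i ∈ Finset.range k, a i / max ((i : ℝ) + 1) m| < b) {k : ℕ} (hk : m ≤ k) :
    |∑ i ∈ Finset.range k, a i| < 2 * b * k := by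
  have hm' : (1 : ℝ) ≤ m := by exact_mod_cast hm
  have hk' : (m : ℝ) ≤ k := by exact_mod_cast hk
  have hb : 0 < b := by simpa using hT 0
  have key : ∀ k : ℕ, |∑ i ∈ Finset.range k, a i - max (k : ℝ) m *
      ∑ i ∈ Finset.range k, a i / max ((i : ℝ) + 1) m| ≤ (max (k : ℝ) m - m) * b := by
    intro k
    induction k with
    | zero => simp
    | succ k ih =>
      have hL : (1 : ℝ) ≤ max ((k : ℝ) + 1) m := hm'.trans (le_max_right _ _)
      have hmono : max (k : ℝ) m ≤ max ((k : ℝ) + 1) m := max_le_max (by linarith) le_rfl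
      set T := ∑ i ∈ Finset.range k, a i / max ((i : ℝ) + 1) m
      set S := ∑ i ∈ Finset.range k, a i
      have h1 : ∑ i ∈ Finset.range (k + 1), a i - max ((k + 1 : ℕ) : ℝ) m *
          ∑ i ∈ Finset.range (k + 1), a i / max ((i : ℝ) + 1) m
          = (S - max (k : ℝ) m * T) - (max ((k : ℝ) + 1) m - max (k : ℝ) m) * T := by
        rw [Finset.sum_range_succ, Finset.sum_range_succ]
        push_cast
        field_simp
        ring
      rw [h1]
      refine (abs_sub _ _).trans ?_
      rw [abs_mul, abs_of_nonneg (sub_nonneg.2 hmono)]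
      have h2 := mul_le_mul_of_nonneg_left (hT k).le (sub_nonneg.2 hmono)
      push_cast
      linarith
  have h := key k
  rw [max_eq_left hk'] at h
  have h3 : |(k : ℝ) * ∑ i ∈ Finset.range k, a i / max ((i : ℝ) + 1) m| < k * b := by
    rw [abs_mul, abs_of_nonneg (by linarith)]
    exact mul_lt_mul_of_pos_left (hT k) (by linarith)
  have h4 := abs_add_le (∑ i ∈ Finset.range k, a i - (k : ℝ) *
      ∑ i ∈ Finset.range k, a i / max ((i : ℝ) + 1) m)
    ((k : ℝ) * ∑ i ∈ Finset.range k, a i / max ((i : ℝ) + 1) m)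
  rw [sub_add_cancel] at h4
  nlinarith

section LargeNumbers

variable {Ω : Type*} [mΩ : MeasurableSpace Ω] {μ : Measure Ω} {Z : ℕ → Ω → ℝ}

theorem integrable_tailPart {Y : Ω → ℝ} (hY : Integrable Y μ) (x : ℝ) :
    Integrable (fun ω => tailPart x (Y ω)) μ :=
  hY.mono ((measurable_tailPart x).comp_aemeasurable hY.aemeasurable).aestronglyMeasurable
    (Filter.Eventually.of_forall fun ω => by
      rw [Real.norm_of_nonneg (tailPart_nonneg _ _)]
      exact tailPart_le_abs _ _)

theorem integrable_trunc {Y : Ω → ℝ} (hY : Integrable Y μ) (L : ℝ) :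
    Integrable (fun ω => trunc L (Y ω)) μ :=
  hY.mono ((measurable_trunc L).comp_aemeasurable hY.aemeasurable).aestronglyMeasurable
    (Filter.Eventually.of_forall fun _ => abs_trunc_le_abs _ _)

theorem measure_exists_max_le_abs [IsFiniteMeasure μ] (hmeas : ∀ i, Measurable (Z i))
    (hident : ∀ i, IdentDistrib (Z i) (Z 0) μ μ) (hint : Integrable (Z 0) μ) {m : ℕ} {x : ℝ}
    (hx : x ≤ m) :
    μ {ω | ∃ i : ℕ, max ((i : ℝ) + 1) m ≤ |Z i ω|}
      ≤ ENNReal.ofReal (∫ ω, tailPart x (Z 0 ω) ∂μ) := by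
  have hset : {ω | ∃ i : ℕ, max ((i : ℝ) + 1) m ≤ |Z i ω|}
      = ⋃ i : ℕ, {ω | max ((i : ℝ) + 1) m ≤ |Z i ω|} := by
    ext ω; simp
  have hms : ∀ i, MeasurableSet {z : ℝ | max ((i : ℝ) + 1) m ≤ |z|} := fun i =>
    measurableSet_le measurable_const measurable_norm
  rw [hset]
  refine (measure_iUnion_le _).trans ?_
  rw [ENNReal.tsum_eq_iSup_nat]
  refine iSup_le fun n => ?_
  have hterm : ∀ i : ℕ, μ {ω | max ((i : ℝ) + 1) m ≤ |Z i ω|} =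
      ENNReal.ofReal (∫ ω, (if max ((i : ℝ) + 1) m ≤ |Z 0 ω| then (1 : ℝ) else 0) ∂μ) := by
    intro i
    have h1 : (fun ω => if max ((i : ℝ) + 1) m ≤ |Z 0 ω| then (1 : ℝ) else 0)
        = Set.indicator (Z 0 ⁻¹' {z : ℝ | max ((i : ℝ) + 1) m ≤ |z|}) (fun _ => (1 : ℝ)) := by
      ext ω
      simp [Set.indicator]
    rw [h1, integral_indicator_const _ (hmeas 0 (hms i)), smul_eq_mul, mul_one, ofReal_measureReal]
    exact (hident i).measure_mem_eq (hms i)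
  have hI : ∀ i : ℕ, Integrable
      (fun ω => if max ((i : ℝ) + 1) m ≤ |Z 0 ω| then (1 : ℝ) else 0) μ := fun i =>
    Integrable.of_bound ((Measurable.ite (hms i) measurable_const measurable_const).comp
      (hmeas 0)).aestronglyMeasurable 1 (Filter.Eventually.of_forall fun ω => by
        split_ifs <;> simp)
  simp_rw [hterm]
  rw [← ENNReal.ofReal_sum_of_nonneg fun i _ => integral_nonneg fun ω => by
    dsimp only; split_ifs <;> simp]
  refine ENNReal.ofReal_le_ofReal ?_
  rw [← integral_finsetSum _ fun i _ => hI i]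
  exact integral_mono (integrable_finsetSum _ fun i _ => hI i) (integrable_tailPart hint x)
    fun ω => sum_indicator_max_le_tailPart hx _ n

/-- A quantitative strong law of large numbers for integrable i.i.d. variables. -/
theorem measure_exists_sum_ge (hmeas : ∀ i, Measurable (Z i)) (hind : iIndepFun Z μ)
    (hident : ∀ i, IdentDistrib (Z i) (Z 0) μ μ) (hint : Integrable (Z 0) μ)
    (hmean : ∫ ω, Z 0 ω ∂μ = 0) {b : ℝ} (hb : 0 < b) {m : ℕ} (hm : 1 ≤ m) {x : ℝ} (hx : x ≤ m)
    (hU : ∫ ω, tailPart x (Z 0 ω) ∂μ ≤ b) :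
    μ {ω | ∃ k, m ≤ k ∧ 3 * b * k ≤ ∑ i ∈ Finset.range k, Z i ω} ≤
      ENNReal.ofReal (8 * (x ^ 2 / m + ∫ ω, tailPart x (Z 0 ω) ∂μ) / b ^ 2) +
        ENNReal.ofReal (∫ ω, tailPart x (Z 0 ω) ∂μ) := by
  have : IsProbabilityMeasure μ := hind.isProbabilityMeasure
  have hm' : (1 : ℝ) ≤ m := by exact_mod_cast hm
  set L : ℕ → ℝ := fun i => max ((i : ℝ) + 1) m with hLdef
  have hL : ∀ i, 1 ≤ L i := fun i => hm'.trans (le_max_right _ _)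
  set e : ℕ → ℝ := fun i => ∫ ω, trunc (L i) (Z 0 ω) ∂μ with he
  have hE : ∀ i, ∫ ω, trunc (L i) (Z i ω) ∂μ = e i := fun i =>
    ((hident i).comp (measurable_trunc (L i))).integral_eq
  -- Since `Z 0` has mean zero, truncation shifts the mean upward by no more than the tail moment.
  have heU : ∀ i, e i ≤ b := by
    intro i
    refine le_trans ?_ hU
    have h1 : e i = ∫ ω, (trunc (L i) (Z 0 ω) - Z 0 ω) ∂μ := by
      rw [integral_sub (integrable_trunc hint _) hint, hmean, sub_zero]
    rw [h1]
    exact integral_mono ((integrable_trunc hint _).sub hint) (integrable_tailPart hint x)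
      fun ω => trunc_sub_le_tailPart (hx.trans (le_max_right _ _)) _
  set f : ℕ → Ω → ℝ := fun i ω => (trunc (L i) (Z i ω) - e i) / L i with hf
  have hφ : ∀ i, Measurable fun z => (trunc (L i) z - e i) / L i := fun i =>
    ((measurable_trunc (L i)).sub_const _).div_const _
  have hfm : ∀ i, Measurable (f i) := fun i => (hφ i).comp (hmeas i)
  have hfind : iIndepFun f μ := hind.comp _ hφ
  have hY2 : ∀ i j, MemLp (fun ω => trunc (L i) (Z j ω)) 2 μ := fun i j =>
    MemLp.of_bound ((measurable_trunc _).comp (hmeas j)).aestronglyMeasurable (L i)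
      (Filter.Eventually.of_forall fun ω => abs_trunc_le (by linarith [hL i]) _)
  have hfL2 : ∀ i, MemLp (f i) 2 μ := fun i => by
    simp only [hf, div_eq_mul_inv]
    exact ((hY2 i i).sub (memLp_const _)).mul_const _
  have hintZ : ∀ i, Integrable (Z i) μ := fun i => (hident i).integrable_iff.2 hint
  have hfmean : ∀ i, ∫ ω, f i ω ∂μ = 0 := fun i => by
    simp only [hf]
    rw [integral_div, integral_sub (integrable_trunc (hintZ i) _) (integrable_const _), hE]
    simp
  have hfvar : ∀ i, ∫ ω, f i ω ^ 2 ∂μ ≤ ∫ ω, trunc (L i) (Z 0 ω) ^ 2 / L i ^ 2 ∂μ := fun i => by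
    have h1 : ∀ ω, f i ω ^ 2 = (trunc (L i) (Z i ω) - e i) ^ 2 / L i ^ 2 := fun ω => by
      simp only [hf, div_pow]
    simp_rw [h1]
    rw [integral_div, integral_div]
    refine div_le_div_of_nonneg_right ?_ (sq_nonneg _)
    have h2 := variance_eq_integral (μ := μ) (hY2 i i).aemeasurable
    rw [hE] at h2
    rw [← h2]
    refine (variance_le_expectation_sq (hY2 i i).aestronglyMeasurable).trans (le_of_eq ?_)
    exact ((hident i).comp ((measurable_trunc (L i)).pow_const 2)).integral_eq
  have hI : ∀ i, Integrable (fun ω => trunc (L i) (Z 0 ω) ^ 2 / L i ^ 2) μ := fun i =>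
    ((hY2 i 0).integrable_sq).div_const _
  have hkol := measure_exists_le_abs_sum (C := 8 * (x ^ 2 / m + ∫ ω, tailPart x (Z 0 ω) ∂μ))
    (fun i => (hfm i).stronglyMeasurable) hfind hfL2 hfmean hb fun n => by
      refine (Finset.sum_le_sum fun i _ => hfvar i).trans ?_
      rw [← integral_finsetSum _ fun i _ => hI i]
      have hR : 8 * (x ^ 2 / m + ∫ ω, tailPart x (Z 0 ω) ∂μ)
          = ∫ ω, 8 * (x ^ 2 / m + tailPart x (Z 0 ω)) ∂μ := by
        rw [integral_const_mul, integral_add (integrable_const _) (integrable_tailPart hint x)]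
        simp
      rw [hR]
      exact integral_mono (integrable_finsetSum _ fun i _ => hI i)
        (((integrable_const _).add (integrable_tailPart hint x)).const_mul _)
        fun ω => sum_trunc_sq_div_le hm _ n
  refine (measure_mono ?_).trans ((measure_union_le _ _).trans
    (add_le_add hkol (measure_exists_max_le_abs hmeas hident hint hx)))
  rintro ω ⟨k, hk, hsum⟩
  -- If no variable exceeds its truncation level, the sum is the centred sum, below `2 b k`, plus a
  -- drift of at most `b k`; hence the threshold `3 b k`.
  by_contra hcon
  simp only [Set.mem_union, Set.mem_ofPred_eq, not_or, not_exists, not_le] at hcon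
  obtain ⟨hT, hZ⟩ := hcon
  have h1 := abs_sum_lt_of_weighted hm (a := fun i => trunc (L i) (Z i ω) - e i) hT hk
  have h2 : ∑ i ∈ Finset.range k, (trunc (L i) (Z i ω) - e i)
      = ∑ i ∈ Finset.range k, Z i ω - ∑ i ∈ Finset.range k, e i := by
    rw [Finset.sum_sub_distrib]
    congr 1
    exact Finset.sum_congr rfl fun i _ => by rw [trunc, if_pos (hZ i)]
  have h3 : ∑ i ∈ Finset.range k, e i ≤ k * b := by
    refine (Finset.sum_le_sum fun i _ => heU i).trans (by simp)
  rw [h2] at h1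
  have := (abs_lt.1 h1).2
  linarith

end LargeNumbers

/-! ### Analytic estimates for the exponential process and the stitching -/

/-- The quotient of the two sides has derivative `x³ / 9` times an exponential: the lower powers
cancel for these coefficients. Its minimum is therefore 1, at `x = 0`. -/
theorem exp_sub_sq_div_six_le (x : ℝ) : Real.exp (x - x ^ 2 / 6) ≤ 1 + x + x ^ 2 / 3 := by
  set g : ℝ → ℝ := fun x => (1 + x + x ^ 2 / 3) * Real.exp (-x + x ^ 2 / 6) with hg
  have hderiv : ∀ x, HasDerivAt g (x ^ 3 / 9 * Real.exp (-x + x ^ 2 / 6)) x := by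
    intro x
    have h1 : HasDerivAt (fun x : ℝ => 1 + x + x ^ 2 / 3) (1 + 2 * x / 3) x := by
      simpa using ((hasDerivAt_id' x).const_add 1).fun_add ((hasDerivAt_pow 2 x).div_const 3)
    have h2 : HasDerivAt (fun x : ℝ => -x + x ^ 2 / 6) (-1 + 2 * x / 6) x := by
      simpa using (hasDerivAt_id' x).fun_neg.fun_add ((hasDerivAt_pow 2 x).div_const 6)
    refine (h1.fun_mul h2.exp).congr_deriv ?_
    ring
  have hcont : Continuous g := by fun_prop
  have hg0 : g 0 = 1 := by simp [hg]
  have hge : 1 ≤ g x := by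
    rw [← hg0]
    rcases le_total 0 x with hx | hx
    · refine monotoneOn_of_deriv_nonneg (convex_Ici 0) hcont.continuousOn
        (fun y _ => (hderiv y).differentiableAt.differentiableWithinAt) (fun y hy => ?_)
        (Set.mem_Ici.2 le_rfl) hx hx
      rw [interior_Ici] at hy
      have hy' : 0 < y := hy
      rw [(hderiv y).deriv]
      positivity
    · refine antitoneOn_of_deriv_nonpos (convex_Iic 0) hcont.continuousOn
        (fun y _ => (hderiv y).differentiableAt.differentiableWithinAt) (fun y hy => ?_)
        hx (Set.mem_Iic.2 le_rfl) hx
      rw [interior_Iic] at hy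
      have hy' : y < 0 := hy
      rw [(hderiv y).deriv]
      refine mul_nonpos_of_nonpos_of_nonneg ?_ (Real.exp_pos _).le
      nlinarith [mul_pos_of_neg_of_neg hy' hy', sq_nonneg y]
  have h3 : Real.exp (x - x ^ 2 / 6) * g x = 1 + x + x ^ 2 / 3 := by
    have : Real.exp (x - x ^ 2 / 6) * Real.exp (-x + x ^ 2 / 6) = 1 := by
      rw [← Real.exp_add]; simp
    simp only [hg]
    linear_combination (1 + x + x ^ 2 / 3) * this
  rw [← h3]
  exact le_mul_of_one_le_right (Real.exp_pos _).le hge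

/-- A telescoping form of the comparison of `∑ t ^ (-(1 + ε))` with its integral, reduced to `log y
≤ y - 1`. -/
theorem rpow_neg_one_add_le_sub {ε : ℝ} (hε : 0 < ε) {t : ℝ} (ht : 0 < t) :
    (t + 1) ^ (-(1 + ε)) ≤ t ^ (-ε) / ε - (t + 1) ^ (-ε) / ε := by
  have ht1 : 0 < t + 1 := by linarith
  have h1 : (t + 1) ^ (-(1 + ε)) = (t + 1) ^ (-ε) * (t + 1)⁻¹ := by
    rw [neg_add_rev, Real.rpow_add ht1, Real.rpow_neg_one]
  have h2 : t ^ (-ε) = (t + 1) ^ (-ε) * (t / (t + 1)) ^ (-ε) := by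
    rw [← Real.mul_rpow ht1.le (by positivity)]
    congr 1
    field_simp
  have h3 : 1 + ε * (t + 1)⁻¹ ≤ (t / (t + 1)) ^ (-ε) := by
    rw [Real.rpow_def_of_pos (by positivity)]
    have h4 : Real.log (t / (t + 1)) ≤ -(t + 1)⁻¹ := by
      refine (Real.log_le_sub_one_of_pos (by positivity)).trans (le_of_eq ?_)
      field_simp
      ring
    have h5 : ε * (t + 1)⁻¹ ≤ Real.log (t / (t + 1)) * -ε := by nlinarith
    have h6 := Real.add_one_le_exp (Real.log (t / (t + 1)) * -ε)
    linarith
  have hp : 0 < (t + 1) ^ (-ε) := Real.rpow_pos_of_pos ht1 _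
  rw [h1, h2, ← sub_div, le_div_iff₀ hε]
  nlinarith

theorem tsum_ofReal_rpow_le {ε : ℝ} (hε : 0 < ε) {x : ℝ} (hx : 0 < x) {C : ℝ} (hC : 0 ≤ C) :
    ∑' j : ℕ, ENNReal.ofReal ((x + j + 1) ^ (-(1 + ε)) * C)
      ≤ ENNReal.ofReal (x ^ (-ε) / ε * C) := by
  rw [ENNReal.tsum_eq_iSup_nat]
  refine iSup_le fun n => ?_
  rw [← ENNReal.ofReal_sum_of_nonneg fun j _ => by positivity, ← Finset.sum_mul]
  refine ENNReal.ofReal_le_ofReal (mul_le_mul_of_nonneg_right ?_ hC)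
  have key : ∑ j ∈ Finset.range n, (x + j + 1) ^ (-(1 + ε))
      ≤ x ^ (-ε) / ε - (x + n) ^ (-ε) / ε := by
    induction n with
    | zero => simp
    | succ n ih =>
      rw [Finset.sum_range_succ]
      have := rpow_neg_one_add_le_sub hε (t := x + n) (by positivity)
      push_cast
      rw [← add_assoc]
      linarith
  refine key.trans (sub_le_self _ (by positivity))

theorem one_le_zeta {s : ℝ} (hs : 1 < s) : 1 ≤ zeta s := by
  have hsum : Summable fun j : ℕ => ((j : ℝ) + 1) ^ (-s) := by
    have := (summable_nat_add_iff 1).2 (Real.summable_nat_rpow.2 (by linarith : -s < -1))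
    simpa using this
  have := hsum.le_tsum 0 fun j _ => by positivity
  simpa [zeta] using this

/-- The tangent-line bound behind the method of stitching. -/
theorem linear_boundary_le {q u w t : ℝ} (hq : 0 < q) (hu : 0 < u) (ht : 0 < t) (huw : u ≤ w)
    (hwu : w ≤ u * q ^ 2) {s : ℝ} (hs : w * t * ((q + q⁻¹) / √2) ≤ s) :
    t ^ 2 ≤ √2 * t / (u * q) * s - (√2 * t / (u * q)) ^ 2 * w ^ 2 / 2 := by
  have h2 : √2 * √2 = 2 := Real.mul_self_sqrt (by norm_num)
  have h2' : 0 < √2 := by positivity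
  have hθ : 0 < √2 * t / (u * q) := by positivity
  have h3 := mul_le_mul_of_nonneg_left hs hθ.le
  have h4 : √2 * t / (u * q) * (w * t * ((q + q⁻¹) / √2))
      = t ^ 2 * (w * (q ^ 2 + 1) / (u * q ^ 2)) := by
    field_simp
  have h5 : (√2 * t / (u * q)) ^ 2 * w ^ 2 / 2 = t ^ 2 * (w ^ 2 / (u * q) ^ 2) := by
    rw [div_pow, mul_pow, Real.sq_sqrt (by norm_num)]
    ring
  -- The difference factors as `(w - u)(u q² - w) / (u q)²`, which is nonnegative between the two
  -- ends of the epoch.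
  have h6 : 1 + w ^ 2 / (u * q) ^ 2 ≤ w * (q ^ 2 + 1) / (u * q ^ 2) := by
    rw [← sub_nonneg]
    have : w * (q ^ 2 + 1) / (u * q ^ 2) - (1 + w ^ 2 / (u * q) ^ 2)
        = (w - u) * (u * q ^ 2 - w) / (u * q) ^ 2 := by
      field_simp
      ring
    rw [this]
    exact div_nonneg (mul_nonneg (sub_nonneg.2 huw) (sub_nonneg.2 hwu)) (sq_nonneg _)
  rw [h5]
  rw [h4] at h3
  nlinarith [mul_le_mul_of_nonneg_left h6 (sq_nonneg t)]

/-- The law-of-the-iterated-logarithm boundary. -/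
noncomputable def boundary (ε : ℝ) (k : ℕ) : ℝ :=
  cConst ε * √((k : ℝ) * (Real.log (Real.log ((1 + ε) ^ 2 * (k : ℝ))) + lConst ε))

/-- Converts the level of epoch `j` into a function of `k`: the hypotheses give `w (1 + ε)^(j+1) ≤
(1 + ε)² k`, which bounds the epoch index. As `log (2 ζ) ≥ 0`, the factor `1 + ε` may be put on it
too. -/
theorem log_epoch_le {ε : ℝ} (hε : 0 < ε) {w W : ℝ} (hw : 1 < w) {k : ℕ} {j : ℕ}
    (hj : w * (1 + ε) ^ j ≤ W) (hW : W ≤ (1 + ε) * k) :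
    Real.log (2 * zeta (1 + ε) * (Real.logb (1 + ε) w + j + 1) ^ (1 + ε)) ≤
      (1 + ε) * (Real.log (Real.log ((1 + ε) ^ 2 * (k : ℝ))) + lConst ε) := by
  have hη : 0 < 1 + ε := by linarith
  have hlη : 0 < Real.log (1 + ε) := Real.log_pos (by linarith)
  have hζ := one_le_zeta (s := 1 + ε) (by linarith)
  have hx : 0 < Real.logb (1 + ε) w := Real.logb_pos (by linarith) hw
  have hk : (1 : ℝ) < k * (1 + ε) := by
    have h1 : (1 : ℝ) ≤ (1 + ε) ^ j := one_le_pow₀ (by linarith)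
    nlinarith
  have hle : w * (1 + ε) ^ (j + 1) ≤ (1 + ε) ^ 2 * k := by
    rw [pow_succ]; nlinarith
  have h1 : Real.logb (1 + ε) w + j + 1 ≤ Real.log ((1 + ε) ^ 2 * k) / Real.log (1 + ε) := by
    rw [le_div_iff₀ hlη]
    have h2 := Real.log_le_log (by positivity) hle
    rw [Real.log_mul (by positivity) (by positivity), Real.log_pow] at h2
    have h3 : Real.logb (1 + ε) w * Real.log (1 + ε) = Real.log w := by
      rw [Real.logb]; field_simp
    push_cast at h2
    linarith
  have hpos : 0 < Real.logb (1 + ε) w + j + 1 := by positivity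
  have hll : 0 < Real.log ((1 + ε) ^ 2 * k) := by
    refine Real.log_pos ?_
    nlinarith
  have h4 := Real.log_le_log hpos h1
  rw [Real.log_div hll.ne' hlη.ne'] at h4
  rw [Real.log_mul (by positivity) (by positivity), Real.log_rpow hpos, lConst,
    Real.log_div (by positivity) hlη.ne']
  have h5 : 0 ≤ Real.log (2 * zeta (1 + ε)) := Real.log_nonneg (by linarith)
  nlinarith

/-- The self-normalizing variance process. -/
noncomputable def selfVar {Ω : Type*} (ξ : ℕ → Ω → ℝ) (k : ℕ) (ω : Ω) : ℝ :=
  ∑ i ∈ Finset.range k, (ξ i ω ^ 2 + 2) / 3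

/-- Provides the deterministic starting point `2 m / 3` of the epochs. -/
theorem two_thirds_mul_le_selfVar {Ω : Type*} (ξ : ℕ → Ω → ℝ) (k : ℕ) (ω : Ω) :
    2 * (k : ℝ) / 3 ≤ selfVar ξ k ω := by
  have : ∑ i ∈ Finset.range k, (2 / 3 : ℝ) ≤ selfVar ξ k ω := by
    refine Finset.sum_le_sum fun i _ => ?_
    linarith [sq_nonneg (ξ i ω)]
  simp only [Finset.sum_const, Finset.card_range, nsmul_eq_mul] at this
  linarith

/-! ### Self-normalized exponential process and stitching -/

section Stitching

variable {Ω : Type*} [mΩ : MeasurableSpace Ω] {μ : Measure Ω} {ξ : ℕ → Ω → ℝ}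

theorem integrable_exp_selfNormalized [IsFiniteMeasure μ] {Y : Ω → ℝ} (hY : Measurable Y)
    (θ : ℝ) :
    Integrable (fun ω => Real.exp (θ * Y ω - (θ * Y ω) ^ 2 / 6 - θ ^ 2 / 3)) μ := by
  refine Integrable.of_bound (by fun_prop) (Real.exp (3 / 2))
    (Filter.Eventually.of_forall fun ω => ?_)
  rw [Real.norm_of_nonneg (Real.exp_pos _).le]
  refine Real.exp_le_exp.2 ?_
  -- The map `y ↦ y - y² / 6` peaks at `y = 3` with value `3 / 2`.
  nlinarith [sq_nonneg (θ * Y ω - 3), sq_nonneg θ]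

theorem integral_exp_selfNormalized_le [IsProbabilityMeasure μ] {Y : Ω → ℝ} (hY : Measurable Y)
    (hL2 : MemLp Y 2 μ) (hmean : ∫ ω, Y ω ∂μ = 0) (hvar : ∫ ω, Y ω ^ 2 ∂μ ≤ 1) (θ : ℝ) :
    ∫ ω, Real.exp (θ * Y ω - (θ * Y ω) ^ 2 / 6 - θ ^ 2 / 3) ∂μ ≤ 1 := by
  have hint : Integrable Y μ := hL2.integrable one_le_two
  have hint2 : Integrable (fun ω => Y ω ^ 2) μ := hL2.integrable_sq
  have hI : Integrable (fun ω => 1 + θ * Y ω + θ ^ 2 / 3 * Y ω ^ 2) μ :=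
    ((integrable_const _).add (hint.const_mul _)).add (hint2.const_mul _)
  calc ∫ ω, Real.exp (θ * Y ω - (θ * Y ω) ^ 2 / 6 - θ ^ 2 / 3) ∂μ
      ≤ ∫ ω, (1 + θ * Y ω + θ ^ 2 / 3 * Y ω ^ 2) * Real.exp (-(θ ^ 2 / 3)) ∂μ := by
        refine integral_mono (integrable_exp_selfNormalized hY θ) (hI.mul_const _) fun ω => ?_
        dsimp only
        rw [sub_eq_add_neg _ (θ ^ 2 / 3), Real.exp_add]
        refine mul_le_mul_of_nonneg_right ((exp_sub_sq_div_six_le _).trans (le_of_eq ?_))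
          (Real.exp_pos _).le
        ring
    _ = (1 + θ ^ 2 / 3 * ∫ ω, Y ω ^ 2 ∂μ) * Real.exp (-(θ ^ 2 / 3)) := by
        have hI1 : Integrable (fun ω => 1 + θ * Y ω) μ :=
          (integrable_const _).add (hint.const_mul _)
        rw [integral_mul_const, integral_add hI1 (hint2.const_mul _), integral_add (integrable_const _) (hint.const_mul _),
          integral_const_mul, integral_const_mul, hmean]
        simp
    _ ≤ Real.exp (θ ^ 2 / 3) * Real.exp (-(θ ^ 2 / 3)) := by
        refine mul_le_mul_of_nonneg_right ?_ (Real.exp_pos _).le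
        have := Real.add_one_le_exp (θ ^ 2 / 3)
        nlinarith [sq_nonneg θ]
    _ = 1 := by rw [← Real.exp_add]; simp

/-- The weights `(ξ² + 2) / 3` in `selfVar` are those that make the product of the one-step factors
equal to `exp (θ S - θ² W / 2)`. -/
theorem measure_exists_log_le (hmeas : ∀ i, Measurable (ξ i)) (hind : iIndepFun ξ μ)
    (hL2 : ∀ i, MemLp (ξ i) 2 μ) (hmean : ∀ i, ∫ ω, ξ i ω ∂μ = 0)
    (hvar : ∀ i, ∫ ω, ξ i ω ^ 2 ∂μ ≤ 1) (θ : ℝ) {c : ℝ} (hc : 0 < c) :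
    μ {ω | ∃ n, Real.log c ≤ θ * partialSum ξ (n + 1) ω - θ ^ 2 * selfVar ξ (n + 1) ω / 2}
      ≤ ENNReal.ofReal (1 / c) := by
  have : IsProbabilityMeasure μ := hind.isProbabilityMeasure
  have hφ : Measurable fun x : ℝ => Real.exp (θ * x - (θ * x) ^ 2 / 6 - θ ^ 2 / 3) := by fun_prop
  have := measure_exists_le_prod (μ := μ)
    (f := fun i ω => Real.exp (θ * ξ i ω - (θ * ξ i ω) ^ 2 / 6 - θ ^ 2 / 3))
    (fun i => (hφ.comp (hmeas i)).stronglyMeasurable) (hind.comp _ fun _ => hφ)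
    (fun i => integrable_exp_selfNormalized (hmeas i) θ) (fun i ω => (Real.exp_pos _).le)
    (fun i => integral_exp_selfNormalized_le (hmeas i) (hL2 i) (hmean i) (hvar i) θ) hc
  refine (measure_mono ?_).trans this
  rintro ω ⟨n, hn⟩
  refine ⟨n, ?_⟩
  rw [← Real.exp_sum, ← Real.log_le_iff_le_exp hc]
  refine hn.trans (le_of_eq ?_)
  rw [partialSum, selfVar, Finset.mul_sum, Finset.mul_sum, Finset.sum_div,
    ← Finset.sum_sub_distrib]
  refine Finset.sum_congr rfl fun i _ => ?_
  ring

/-- The stitched self-normalized boundary crossing inequality. -/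
theorem measure_exists_boundary_le (hmeas : ∀ i, Measurable (ξ i)) (hind : iIndepFun ξ μ)
    (hL2 : ∀ i, MemLp (ξ i) 2 μ) (hmean : ∀ i, ∫ ω, ξ i ω ∂μ = 0)
    (hvar : ∀ i, ∫ ω, ξ i ω ^ 2 ∂μ ≤ 1) {ε : ℝ} (hε : 0 < ε) {m : ℕ} (hm : 2 ≤ m) :
    μ {ω | ∃ k, m ≤ k ∧ selfVar ξ k ω ≤ (1 + ε) * k ∧ boundary ε k ≤ |partialSum ξ k ω|} ≤
      ENNReal.ofReal (Real.logb (1 + ε) (2 * (m : ℝ) / 3) ^ (-ε) / (ε * zeta (1 + ε))) := by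
  have hη : 0 < 1 + ε := by linarith
  have hm' : (2 : ℝ) ≤ m := by exact_mod_cast hm
  have hζ := one_le_zeta (s := 1 + ε) (by linarith)
  set w : ℝ := 2 * (m : ℝ) / 3 with hw
  have hw1 : 1 < w := by rw [hw]; linarith
  set x := Real.logb (1 + ε) w with hxdef
  have hx : 0 < x := Real.logb_pos (by linarith) hw1
  -- Two sides at level `c j` cost `2 / c j = (x + j + 1) ^ (-(1 + ε)) / ζ(1 + ε)`, which is
  -- summable.
  set c : ℕ → ℝ := fun j => 2 * zeta (1 + ε) * (x + j + 1) ^ (1 + ε) with hc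
  have hc1 : ∀ j, 1 < c j := by
    intro j
    have h1 : (1 : ℝ) ≤ (x + j + 1) ^ (1 + ε) :=
      Real.one_le_rpow (by have : (0 : ℝ) ≤ j := by positivity
                           linarith) hη.le
    simp only [hc]
    nlinarith
  set q : ℝ := (1 + ε) ^ (1 / 4 : ℝ) with hq
  have hq0 : 0 < q := by positivity
  have hq4 : q ^ 4 = 1 + ε := by
    rw [hq, ← Real.rpow_natCast, ← Real.rpow_mul hη.le]; norm_num
  have hcq : cConst ε = (1 + ε) * ((q + q⁻¹) / √2) := by
    have h1 : (1 + ε) ^ (5 / 4 : ℝ) = (1 + ε) * q := by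
      rw [hq, show (5 / 4 : ℝ) = 1 + 1 / 4 by norm_num, Real.rpow_add hη, Real.rpow_one]
    have h2 : (1 + ε) ^ (3 / 4 : ℝ) = (1 + ε) * q⁻¹ := by
      rw [hq, show (3 / 4 : ℝ) = 1 + -(1 / 4) by norm_num, Real.rpow_add hη, Real.rpow_one,
        Real.rpow_neg hη.le]
    rw [cConst, h1, h2]
    ring
  set t : ℕ → ℝ := fun j => √(Real.log (c j)) with ht
  have ht0 : ∀ j, 0 < t j := fun j => Real.sqrt_pos.2 (Real.log_pos (hc1 j))
  have ht2 : ∀ j, t j ^ 2 = Real.log (c j) := fun j => Real.sq_sqrt (Real.log_pos (hc1 j)).le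
  set u : ℕ → ℝ := fun j => √(w * (1 + ε) ^ j) with hu
  have hu0 : ∀ j, 0 < u j := fun j => Real.sqrt_pos.2 (by positivity)
  -- In epoch `j`, `√W` lies between `u j` and `u j * q²`. The slope makes the line touch the curve
  -- `√2 * t j * √W` at the geometric mean `u j * q`, so the loss at the ends is the factor `(q +
  -- q⁻¹) / 2`.
  set θ : ℕ → ℝ := fun j => √2 * t j / (u j * q) with hθ
  set E : ℝ → ℕ → Set Ω := fun r j => {ω | ∃ n, Real.log (c j) ≤
    r * partialSum ξ (n + 1) ω - r ^ 2 * selfVar ξ (n + 1) ω / 2} with hE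
  have hEle : ∀ r j, μ (E r j) ≤ ENNReal.ofReal (1 / c j) := fun r j =>
    measure_exists_log_le hmeas hind hL2 hmean hvar r (by linarith [hc1 j])
  have hsub : {ω | ∃ k, m ≤ k ∧ selfVar ξ k ω ≤ (1 + ε) * k ∧
      boundary ε k ≤ |partialSum ξ k ω|} ⊆ ⋃ j, (E (θ j) j ∪ E (-θ j) j) := by
    rintro ω ⟨k, hk, hW, hS⟩
    have hk' : (m : ℝ) ≤ k := by exact_mod_cast hk
    have hwW : w ≤ selfVar ξ k ω := by
      refine le_trans ?_ (two_thirds_mul_le_selfVar ξ k ω)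
      rw [hw]; linarith
    set W := selfVar ξ k ω with hWdef
    have hW0 : 0 < W := by linarith
    obtain ⟨j, hj1, hj2⟩ := exists_nat_pow_near (x := W / w) (y := 1 + ε)
      ((one_le_div (by linarith)).2 hwW) (by linarith)
    rw [le_div_iff₀ (by linarith)] at hj1
    rw [div_lt_iff₀ (by linarith)] at hj2
    have hlog := log_epoch_le hε hw1 (j := j) (by linarith) hW
    rw [← hxdef] at hlog
    set R := Real.log (Real.log ((1 + ε) ^ 2 * (k : ℝ))) + lConst ε with hR
    have huw : u j ≤ √W := Real.sqrt_le_sqrt (by linarith)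
    have hwu : √W ≤ u j * q ^ 2 := by
      refine Real.sqrt_le_iff.2 ⟨by positivity, ?_⟩
      have : (u j * q ^ 2) ^ 2 = w * (1 + ε) ^ j * (1 + ε) := by
        rw [mul_pow, ← pow_mul, hu, Real.sq_sqrt (by positivity)]
        rw [hq4]
      rw [this, mul_assoc, ← pow_succ]
      linarith
    -- One factor `√(1 + ε)` comes from `W ≤ (1 + ε) k`, the other from `log_epoch_le`.
    have hwt : √W * t j ≤ (1 + ε) * √(k * R) := by
      rw [ht, ← Real.sqrt_mul hW0.le]
      refine Real.sqrt_le_iff.2 ⟨by positivity, ?_⟩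
      have hR0 : 0 < R := by
        have := (Real.log_pos (hc1 j)).trans_le hlog
        exact pos_of_mul_pos_right this hη.le
      rw [mul_pow, Real.sq_sqrt (by positivity)]
      calc W * Real.log (c j) ≤ ((1 + ε) * k) * ((1 + ε) * R) :=
            mul_le_mul hW hlog (Real.log_pos (hc1 j)).le (by positivity)
        _ = (1 + ε) ^ 2 * (k * R) := by ring
    have hbd : √W * t j * ((q + q⁻¹) / √2) ≤ |partialSum ξ k ω| := by
      refine le_trans ?_ hS
      rw [boundary, hcq]
      calc √W * t j * ((q + q⁻¹) / √2) ≤ (1 + ε) * √(k * R) * ((q + q⁻¹) / √2) :=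
            mul_le_mul_of_nonneg_right hwt (by positivity)
        _ = (1 + ε) * ((q + q⁻¹) / √2) * √(k * R) := by ring
    have hfin := linear_boundary_le hq0 (hu0 j) (ht0 j) huw hwu hbd
    rw [ht2, Real.sq_sqrt hW0.le] at hfin
    obtain ⟨n, rfl⟩ : ∃ n, k = n + 1 := ⟨k - 1, by omega⟩
    refine Set.mem_iUnion.2 ⟨j, ?_⟩
    rcases abs_choice (partialSum ξ (n + 1) ω) with h | h
    · left
      rw [h] at hfin
      exact ⟨n, hfin⟩
    · right
      rw [h] at hfin
      refine ⟨n, hfin.trans (le_of_eq ?_)⟩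
      simp only [hθ, ← hWdef]
      ring
  have hζ0 : 0 < zeta (1 + ε) := by linarith
  calc μ {ω | ∃ k, m ≤ k ∧ selfVar ξ k ω ≤ (1 + ε) * k ∧ boundary ε k ≤ |partialSum ξ k ω|}
      ≤ ∑' j, μ (E (θ j) j ∪ E (-θ j) j) := (measure_mono hsub).trans (measure_iUnion_le _)
    _ ≤ ∑' j : ℕ, ENNReal.ofReal ((x + j + 1) ^ (-(1 + ε)) * (zeta (1 + ε))⁻¹) := by
        refine ENNReal.tsum_le_tsum fun j => ?_
        have hcj : 0 ≤ 1 / c j := by have := hc1 j; positivity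
        refine (measure_union_le _ _).trans ((add_le_add (hEle _ j) (hEle _ j)).trans ?_)
        rw [← ENNReal.ofReal_add hcj hcj]
        refine ENNReal.ofReal_le_ofReal (le_of_eq ?_)
        have hp : 0 < x + j + 1 := by positivity
        simp only [hc]
        rw [Real.rpow_neg hp.le]
        field_simp
        ring
    _ ≤ ENNReal.ofReal (x ^ (-ε) / ε * (zeta (1 + ε))⁻¹) :=
        tsum_ofReal_rpow_le hε hx (by positivity)
    _ = ENNReal.ofReal (x ^ (-ε) / (ε * zeta (1 + ε))) := by
        congr 1
        field_simp

end Stitching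

/-! ### Positivity of the boundary and its dependence on ε -/

theorem cConst_pos {ε : ℝ} (hε : 0 < ε) : 0 < cConst ε := by
  unfold cConst; positivity

theorem cConst_lt_cConst {ε' ε : ℝ} (hε' : 0 < ε') (h : ε' < ε) : cConst ε' < cConst ε := by
  unfold cConst
  have h1 := Real.rpow_lt_rpow (x := 1 + ε') (y := 1 + ε) (z := 5 / 4) (by linarith) (by linarith)
    (by norm_num)
  have h2 := Real.rpow_lt_rpow (x := 1 + ε') (y := 1 + ε) (z := 3 / 4) (by linarith) (by linarith)
    (by norm_num)
  gcongr

theorem loglog_add_lConst_pos {ε : ℝ} (hε : 0 < ε) {k : ℕ} (hk : 1 ≤ k) :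
    0 < Real.log (Real.log ((1 + ε) ^ 2 * (k : ℝ))) + lConst ε := by
  have hk' : (1 : ℝ) ≤ k := by exact_mod_cast hk
  have hlη : 0 < Real.log (1 + ε) := Real.log_pos (by linarith)
  have hζ := one_le_zeta (s := 1 + ε) (by linarith)
  have h1 : 2 * Real.log (1 + ε) ≤ Real.log ((1 + ε) ^ 2 * (k : ℝ)) := by
    rw [← Nat.cast_ofNat (R := ℝ) (n := 2), ← Real.log_pow]
    exact Real.log_le_log (by positivity) (le_mul_of_one_le_right (by positivity) hk')
  have h2 : 0 < Real.log ((1 + ε) ^ 2 * (k : ℝ)) := by linarith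
  rw [lConst, ← Real.log_mul h2.ne' (by positivity)]
  refine Real.log_pos ?_
  rw [← mul_div_assoc, lt_div_iff₀ hlη]
  nlinarith

theorem boundary_pos {ε : ℝ} (hε : 0 < ε) {k : ℕ} (hk : 1 ≤ k) : 0 < boundary ε k := by
  have hk' : (0 : ℝ) < k := by exact_mod_cast hk
  exact mul_pos (cConst_pos hε) (Real.sqrt_pos.2 (mul_pos hk' (loglog_add_lConst_pos hε hk)))

/-- `cConst` is strictly increasing, so a constant `d` fits strictly between its two values; the
diverging iterated logarithm then outweighs the two `lConst` terms. -/
theorem exists_boundary_le_mul_boundary {ε' ε : ℝ} (hε' : 0 < ε') (h : ε' < ε) :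
    ∃ δ < 1, ∀ᶠ k : ℕ in Filter.atTop, boundary ε' k ≤ δ * boundary ε k := by
  have hc' := cConst_pos hε'
  have hc := cConst_pos (hε'.trans h)
  have hlt := cConst_lt_cConst hε' h
  set d := (cConst ε' + cConst ε) / 2 with hd
  refine ⟨d / cConst ε, (div_lt_one hc).2 (by linarith), ?_⟩
  have hη : (0 : ℝ) < (1 + ε) ^ 2 := by
    have := hε'.trans h
    positivity
  have hgap : 0 < d ^ 2 - cConst ε' ^ 2 := by
    have : cConst ε' < d := by linarith
    nlinarith
  have htend : Filter.Tendsto (fun k : ℕ => Real.log (Real.log ((1 + ε) ^ 2 * (k : ℝ))))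
      Filter.atTop Filter.atTop :=
    Real.tendsto_log_atTop.comp (Real.tendsto_log_atTop.comp
      (tendsto_natCast_atTop_atTop.const_mul_atTop hη))
  filter_upwards [htend.eventually_ge_atTop
    ((cConst ε' ^ 2 * lConst ε' - d ^ 2 * lConst ε) / (d ^ 2 - cConst ε' ^ 2)),
    Filter.eventually_ge_atTop 2] with k hk hk2
  have hk2' : (2 : ℝ) ≤ k := by exact_mod_cast hk2
  rw [div_le_iff₀ hgap] at hk
  have hll : Real.log (Real.log ((1 + ε') ^ 2 * (k : ℝ))) ≤
      Real.log (Real.log ((1 + ε) ^ 2 * (k : ℝ))) := by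
    have h1 : 1 < (1 + ε') ^ 2 * (k : ℝ) := by nlinarith
    refine Real.log_le_log (Real.log_pos h1) (Real.log_le_log (by linarith) ?_)
    gcongr
  rw [boundary, boundary, ← mul_assoc, div_mul_cancel₀ _ hc.ne',
    ← Real.sqrt_sq hc'.le, ← Real.sqrt_sq (by linarith : 0 ≤ d), ← Real.sqrt_mul (sq_nonneg _),
    ← Real.sqrt_mul (sq_nonneg _)]
  refine Real.sqrt_le_sqrt ?_
  have h3 : cConst ε' ^ 2 * (Real.log (Real.log ((1 + ε') ^ 2 * (k : ℝ))) + lConst ε') ≤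
      d ^ 2 * (Real.log (Real.log ((1 + ε) ^ 2 * (k : ℝ))) + lConst ε) := by
    nlinarith [mul_le_mul_of_nonneg_left hll (sq_nonneg (cConst ε'))]
  nlinarith

/-! ### Crossing probabilities -/

section Probability

variable {Ω : Type*} [mΩ : MeasurableSpace Ω] {P : Measure Ω}

theorem truncMoment_eq_integral_tailPart (Y : Ω → ℝ) (x : ℝ) :
    truncMoment P Y x = ∫ ω, tailPart x (Y ω ^ 2 - variance Y P) ∂P := by
  rw [truncMoment]
  congr 1

theorem truncMoment_nonneg (Y : Ω → ℝ) (x : ℝ) : 0 ≤ truncMoment P Y x := by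
  rw [truncMoment_eq_integral_tailPart]
  exact integral_nonneg fun ω => tailPart_nonneg _ _

theorem tendsto_integral_tailPart {Y : Ω → ℝ} (hY : Integrable Y P) {u : ℕ → ℝ}
    (hu : Filter.Tendsto u Filter.atTop Filter.atTop) :
    Filter.Tendsto (fun n => ∫ ω, tailPart (u n) (Y ω) ∂P) Filter.atTop (nhds 0) := by
  have h0 : ∫ _ : Ω, (0 : ℝ) ∂P = 0 := by simp
  rw [← h0]
  refine tendsto_integral_of_dominated_convergence (fun ω => |Y ω|)
    (fun n => (integrable_tailPart hY _).aestronglyMeasurable) hY.abs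
    (fun n => Filter.Eventually.of_forall fun ω => ?_) (Filter.Eventually.of_forall fun ω => ?_)
  · rw [Real.norm_of_nonneg (tailPart_nonneg _ _)]
    exact tailPart_le_abs _ _
  · refine tendsto_const_nhds.congr' ?_
    filter_upwards [hu.eventually_gt_atTop |Y ω|] with n hn
    rw [tailPart, if_neg (not_le.2 hn)]

/-- The right-hand side of the inequality. -/
noncomputable def crossingBound (P : Measure Ω) (Y : Ω → ℝ) (σ lam ε : ℝ) (m : ℕ) : ℝ :=
  (Real.logb (1 + ε) (2 * (m : ℝ) / 3)) ^ (-ε) / (ε * zeta (1 + ε))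
    + 262 / min (ε ^ 2 * σ ^ 4) 1 * ((m : ℝ) ^ (2 * lam - 1) + truncMoment P Y ((m : ℝ) ^ lam))

theorem tendsto_crossingBound [IsFiniteMeasure P] {Y : Ω → ℝ} (hL2 : MemLp Y 2 P) {σ lam ε : ℝ}
    (hε : 0 < ε) (hlam0 : 0 < lam) (hlam1 : lam < 1 / 2) :
    Filter.Tendsto (crossingBound P Y σ lam ε) Filter.atTop (nhds 0) := by
  have hcast := tendsto_natCast_atTop_atTop (R := ℝ)
  have h1 : Filter.Tendsto (fun m : ℕ => Real.logb (1 + ε) (2 * (m : ℝ) / 3) ^ (-ε))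
      Filter.atTop (nhds 0) := by
    refine (tendsto_rpow_neg_atTop hε).comp ((Real.tendsto_logb_atTop (by linarith)).comp ?_)
    exact (hcast.const_mul_atTop (by norm_num)).atTop_div_const (by norm_num)
  have h2 : Filter.Tendsto (fun m : ℕ => (m : ℝ) ^ (2 * lam - 1)) Filter.atTop (nhds 0) := by
    have := (tendsto_rpow_neg_atTop (y := 1 - 2 * lam) (by linarith)).comp hcast
    simpa [Function.comp_def] using this
  have h3 : Filter.Tendsto (fun m : ℕ => truncMoment P Y ((m : ℝ) ^ lam))
      Filter.atTop (nhds 0) := by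
    simp_rw [truncMoment_eq_integral_tailPart]
    exact tendsto_integral_tailPart (hL2.integrable_sq.sub (integrable_const _))
      ((tendsto_rpow_atTop hlam0).comp hcast)
  have := (h1.div_const (ε * zeta (1 + ε))).add
    ((h2.add h3).const_mul (262 / min (ε ^ 2 * σ ^ 4) 1))
  simpa [funext fun m => crossingBound.eq_1 P Y σ lam ε m] using this

/-- Disposes of the case in which the strong law does not apply: with `b = ε σ²`, `min (b²) 1 ≤ b`,
so a tail moment above `b` makes the bound trivial. -/
theorem one_le_crossingBound_of_lt_truncMoment {Y : Ω → ℝ} {σ lam ε : ℝ} (hσ : 0 < σ)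
    (hε : 0 < ε) {m : ℕ} (hm : 2 ≤ m)
    (h : ε * σ ^ 2 < truncMoment P Y ((m : ℝ) ^ lam)) : 1 ≤ crossingBound P Y σ lam ε m := by
  have hm' : (2 : ℝ) ≤ m := by exact_mod_cast hm
  have hζ := one_le_zeta (s := 1 + ε) (by linarith)
  have hx : 0 < Real.logb (1 + ε) (2 * (m : ℝ) / 3) := Real.logb_pos (by linarith) (by linarith)
  have hA : 0 ≤ (Real.logb (1 + ε) (2 * (m : ℝ) / 3)) ^ (-ε) / (ε * zeta (1 + ε)) := by positivity
  have hy : 0 ≤ (m : ℝ) ^ (2 * lam - 1) := by positivity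
  set b := ε * σ ^ 2 with hb
  have hb0 : 0 < b := by positivity
  have hbb : ε ^ 2 * σ ^ 4 = b ^ 2 := by rw [hb]; ring
  have hD : 0 < min (b ^ 2) 1 := by positivity
  have hDb : min (b ^ 2) 1 ≤ b := by
    rcases le_total b 1 with h1 | h1
    · exact (min_le_left _ _).trans (by nlinarith)
    · exact (min_le_right _ _).trans h1
  have hB : 1 ≤ 262 / min (b ^ 2) 1 *
      ((m : ℝ) ^ (2 * lam - 1) + truncMoment P Y ((m : ℝ) ^ lam)) := by
    rw [div_mul_eq_mul_div, le_div_iff₀ hD]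
    linarith
  rw [crossingBound, hbb]
  linarith

section Crossing

variable [IsProbabilityMeasure P] {X : ℕ → Ω → ℝ} {σ lam ε : ℝ}

theorem measure_exists_boundary_le_crossingBound (hmeas : ∀ i, Measurable (X i))
    (hindep : iIndepFun X P) (hident : ∀ i, IdentDistrib (X i) (X 0) P P)
    (hmean : ∫ ω, X 0 ω ∂P = 0) (hσ : 0 < σ) (hL2 : MemLp (X 0) 2 P)
    (hvar : variance (X 0) P ≤ σ ^ 2) (hε : 0 < ε) (hlam1 : lam < 1 / 2)
    {m : ℕ} (hm : 2 ≤ m) :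
    P {ω | ∃ k, m ≤ k ∧ boundary ε k ≤ |partialSum X k ω / σ|}
      ≤ ENNReal.ofReal (crossingBound P (X 0) σ lam ε m) := by
  by_cases hU : ε * σ ^ 2 < truncMoment P (X 0) ((m : ℝ) ^ lam)
  · refine prob_le_one.trans ?_
    rw [ENNReal.one_le_ofReal]
    exact one_le_crossingBound_of_lt_truncMoment hσ hε hm hU
  rw [not_lt] at hU
  have hm' : (2 : ℝ) ≤ m := by exact_mod_cast hm
  have hζ := one_le_zeta (s := 1 + ε) (by linarith)
  have hx : 0 < Real.logb (1 + ε) (2 * (m : ℝ) / 3) := Real.logb_pos (by linarith) (by linarith)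
  have hA : 0 ≤ (Real.logb (1 + ε) (2 * (m : ℝ) / 3)) ^ (-ε) / (ε * zeta (1 + ε)) := by positivity
  have hvar2 : variance (X 0) P = ∫ ω, X 0 ω ^ 2 ∂P :=
    variance_of_integral_eq_zero (hmeas 0).aemeasurable hmean
  set v := variance (X 0) P with hv
  set b := ε * σ ^ 2 with hb
  have hb0 : 0 < b := by positivity
  set ξ : ℕ → Ω → ℝ := fun i ω => X i ω / σ with hξ
  set Z : ℕ → Ω → ℝ := fun i ω => X i ω ^ 2 - v with hZ
  have hsumξ : ∀ k ω, partialSum ξ k ω = partialSum X k ω / σ := fun k ω => by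
    simp only [partialSum, hξ, Finset.sum_div]
  have hdivm : Measurable fun x : ℝ => x / σ := measurable_id.div_const σ
  have hsqm : Measurable fun x : ℝ => x ^ 2 - v := (measurable_id.pow_const 2).sub_const v
  have hL2i : ∀ i, MemLp (X i) 2 P := fun i => (hident i).memLp_iff.2 hL2
  have hstitch := measure_exists_boundary_le (μ := P) (ξ := ξ) (fun i => hdivm.comp (hmeas i))
    (hindep.comp _ fun _ => hdivm)
    (fun i => by simpa only [hξ, div_eq_mul_inv] using (hL2i i).mul_const σ⁻¹)
    (fun i => by simp only [hξ]; rw [integral_div, (hident i).integral_eq, hmean, zero_div])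
    (fun i => by
      simp only [hξ, div_pow]
      rw [integral_div, div_le_one (by positivity)]
      refine le_of_eq_of_le ?_ (hvar2 ▸ hvar)
      exact ((hident i).comp (measurable_id.pow_const 2)).integral_eq) hε hm
  have hxm : (m : ℝ) ^ lam ≤ m := by
    calc (m : ℝ) ^ lam ≤ (m : ℝ) ^ (1 : ℝ) :=
          Real.rpow_le_rpow_of_exponent_le (by linarith) (by linarith)
      _ = m := Real.rpow_one _
  have hUeq := truncMoment_eq_integral_tailPart (P := P) (X 0) ((m : ℝ) ^ lam)
  have hlln := measure_exists_sum_ge (μ := P) (Z := Z) (fun i => hsqm.comp (hmeas i))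
    (hindep.comp _ fun _ => hsqm) (fun i => (hident i).comp hsqm)
    (hL2.integrable_sq.sub (integrable_const v))
    (by
      simp only [hZ]
      rw [integral_sub hL2.integrable_sq (integrable_const v), ← hvar2]
      simp)
    hb0 (by omega : 1 ≤ m) hxm (hUeq ▸ hU)
  simp only [hZ] at hlln
  rw [← hUeq] at hlln
  have hsub : {ω | ∃ k, m ≤ k ∧ boundary ε k ≤ |partialSum X k ω / σ|} ⊆
      {ω | ∃ k, m ≤ k ∧ selfVar ξ k ω ≤ (1 + ε) * k ∧ boundary ε k ≤ |partialSum ξ k ω|} ∪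
      {ω | ∃ k, m ≤ k ∧ 3 * b * k ≤ ∑ i ∈ Finset.range k, (X i ω ^ 2 - v)} := by
    rintro ω ⟨k, hk, hS⟩
    by_cases hW : selfVar ξ k ω ≤ (1 + ε) * k
    · exact Or.inl ⟨k, hk, hW, by rwa [hsumξ]⟩
    · refine Or.inr ⟨k, hk, ?_⟩
      rw [not_le] at hW
      -- Multiplying by `3 σ²` clears the denominators of `selfVar`; with `v ≤ σ²`, an excess of `ε
      -- k` becomes `3 b k`, the threshold of the strong law.
      have h1 : selfVar ξ k ω * (3 * σ ^ 2)
          = ∑ i ∈ Finset.range k, (X i ω ^ 2 - v) + k * (v + 2 * σ ^ 2) := by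
        have : (k : ℝ) * (v + 2 * σ ^ 2) = ∑ i ∈ Finset.range k, (v + 2 * σ ^ 2) := by
          rw [Finset.sum_const, Finset.card_range, nsmul_eq_mul]
        rw [this, ← Finset.sum_add_distrib, selfVar, Finset.sum_mul]
        refine Finset.sum_congr rfl fun i _ => ?_
        simp only [hξ]
        field_simp
        ring
      have h2 := mul_lt_mul_of_pos_right hW (by positivity : 0 < 3 * σ ^ 2)
      have h3 : (k : ℝ) * v ≤ k * σ ^ 2 := mul_le_mul_of_nonneg_left hvar (by positivity)
      rw [hb]
      nlinarith
  have hU0 := truncMoment_nonneg (P := P) (X 0) ((m : ℝ) ^ lam)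
  have hpow : ((m : ℝ) ^ lam) ^ 2 / m = (m : ℝ) ^ (2 * lam - 1) := by
    rw [← Real.rpow_natCast, ← Real.rpow_mul (by linarith), Real.rpow_sub_one (by linarith)]
    congr 2
    push_cast
    ring
  rw [hpow] at hlln
  have hy : 0 ≤ (m : ℝ) ^ (2 * lam - 1) := by positivity
  refine (measure_mono hsub).trans ((measure_union_le _ _).trans
    ((add_le_add hstitch hlln).trans ?_))
  rw [← ENNReal.ofReal_add (by positivity) hU0, ← ENNReal.ofReal_add hA (by positivity)]
  refine ENNReal.ofReal_le_ofReal (add_le_add le_rfl ?_)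
  have hbb : ε ^ 2 * σ ^ 4 = b ^ 2 := by rw [hb]; ring
  rw [hbb]
  set U := truncMoment P (X 0) ((m : ℝ) ^ lam)
  set y := (m : ℝ) ^ (2 * lam - 1)
  have hD : 0 < min (b ^ 2) 1 := by positivity
  have h1 : 8 * (y + U) / b ^ 2 ≤ 8 * (y + U) / min (b ^ 2) 1 := by
    gcongr
    exact min_le_left _ _
  have h2 : U ≤ U / min (b ^ 2) 1 := by
    rw [le_div_iff₀ hD]
    exact mul_le_of_le_one_right hU0 (min_le_right _ _)
  calc 8 * (y + U) / b ^ 2 + U ≤ 8 * (y + U) / min (b ^ 2) 1 + U / min (b ^ 2) 1 :=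
        add_le_add h1 h2
    _ = (8 * (y + U) + U) / min (b ^ 2) 1 := by rw [add_div]
    -- The coefficient 9 would already suffice here.
    _ ≤ (262 * (y + U)) / min (b ^ 2) 1 := by gcongr; linarith
    _ = 262 / min (b ^ 2) 1 * (y + U) := by ring

/-- Some fraction of the boundary is almost surely exceeded only finitely often. -/
theorem exists_measure_frequently_boundary_eq_zero (hmeas : ∀ i, Measurable (X i))
    (hindep : iIndepFun X P) (hident : ∀ i, IdentDistrib (X i) (X 0) P P)
    (hmean : ∫ ω, X 0 ω ∂P = 0) (hσ : 0 < σ) (hL2 : MemLp (X 0) 2 P)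
    (hvar : variance (X 0) P ≤ σ ^ 2) (hε : 0 < ε) :
    ∃ δ < 1, P {ω | ∀ M : ℕ, ∃ k, M ≤ k ∧ δ * boundary ε k ≤ |partialSum X k ω / σ|} = 0 := by
  obtain ⟨δ, hδ, hev⟩ := exists_boundary_le_mul_boundary (half_pos hε) (half_lt_self hε)
  refine ⟨δ, hδ, ?_⟩
  -- Any exponent in `(0, 1/2)` would do in place of `1 / 4`.
  have htend := ENNReal.tendsto_ofReal (tendsto_crossingBound (σ := σ) (lam := 1 / 4) hL2
    (half_pos hε) (by norm_num) (by norm_num))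
  rw [ENNReal.ofReal_zero] at htend
  refine le_antisymm (ge_of_tendsto htend ?_) zero_le
  filter_upwards [Filter.eventually_forall_ge_atTop.2 hev, Filter.eventually_ge_atTop 2] with M hM hM2
  refine (measure_mono ?_).trans (measure_exists_boundary_le_crossingBound hmeas hindep hident
    hmean hσ hL2 hvar (half_pos hε) (by norm_num) hM2)
  intro ω hω
  obtain ⟨k, hk, h⟩ := hω M
  exact ⟨k, hk, (hM k hk).trans h⟩

end Crossing

end Probability

/-! ### From attained crossings to the supremum -/

theorem exists_lt_one_forall_le {r : ℕ → ℝ} {δ : ℝ} (hδ : δ < 1) {m M : ℕ}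
    (hr : ∀ k, m ≤ k → r k < 1) (hM : ∀ k, M ≤ k → r k ≤ δ) :
    ∃ ρ < 1, ∀ k, m ≤ k → r k ≤ ρ := by
  have key : ∀ N : ℕ, ∃ ρ < 1, δ ≤ ρ ∧ ∀ k < N, m ≤ k → r k ≤ ρ := by
    intro N
    induction N with
    | zero => exact ⟨δ, hδ, le_rfl, by simp⟩
    | succ N ih =>
      obtain ⟨ρ, hρ, hδρ, h⟩ := ih
      by_cases hN : m ≤ N
      · refine ⟨max ρ (r N), max_lt hρ (hr N hN), hδρ.trans (le_max_left _ _), fun k hk hmk => ?_⟩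
        rcases Nat.lt_succ_iff_lt_or_eq.1 hk with hk | rfl
        · exact (h k hk hmk).trans (le_max_left _ _)
        · exact le_max_right _ _
      · exact ⟨ρ, hρ, hδρ, fun k hk hmk => h k (by omega) hmk⟩
  obtain ⟨ρ, hρ, hδρ, h⟩ := key M
  refine ⟨ρ, hρ, fun k hk => ?_⟩
  rcases lt_or_ge k M with h1 | h1
  · exact h k h1 hk
  · exact (hM k h1).trans hδρ

end LILInequality

theorem mainTheorem3 {Ω : Type*} [MeasurableSpace Ω] (P : Measure Ω) [IsProbabilityMeasure P]
    (X : ℕ → Ω → ℝ) (hmeas : ∀ i, Measurable (X i))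
    (hindep : iIndepFun X P) (hident : ∀ i, IdentDistrib (X i) (X 0) P P)
    (hint : Integrable (X 0) P) (hmean : ∫ ω, X 0 ω ∂P = 0)
    (σ : ℝ) (hσ : 0 < σ) (hL2 : MemLp (X 0) 2 P) (hvar : variance (X 0) P ≤ σ ^ 2)
    (ε : ℝ) (hε : 0 < ε) (lam : ℝ) (hlam0 : 0 < lam) (hlam1 : lam < 1 / 2)
    (m : ℕ) (hm : 2 ≤ m) :
    P.real {ω | (1 : EReal) ≤ ⨆ k : ℕ, ⨆ _ : m ≤ k,
        ((|LILInequality.partialSum X k ω / σ| /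
          (LILInequality.cConst ε * Real.sqrt ((k : ℝ) *
            (Real.log (Real.log ((1 + ε) ^ 2 * (k : ℝ))) + LILInequality.lConst ε))) : ℝ) : EReal)}
      ≤ (Real.logb (1 + ε) (2 * (m : ℝ) / 3)) ^ (-ε) / (ε * LILInequality.zeta (1 + ε))
        + 262 / min (ε ^ 2 * σ ^ 4) 1 *
          ((m : ℝ) ^ (2 * lam - 1) + LILInequality.truncMoment P (X 0) ((m : ℝ) ^ lam)) := by
  open LILInequality in
  have hm' : (2 : ℝ) ≤ m := by exact_mod_cast hm
  have hζ := one_le_zeta (s := 1 + ε) (by linarith)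
  have hx : 0 < Real.logb (1 + ε) (2 * (m : ℝ) / 3) := Real.logb_pos (by linarith) (by linarith)
  have hU0 := truncMoment_nonneg (P := P) (X 0) ((m : ℝ) ^ lam)
  obtain ⟨δ, hδ, hnull⟩ := exists_measure_frequently_boundary_eq_zero hmeas hindep hident hmean
    hσ hL2 hvar hε
  refine ENNReal.toReal_le_of_le_ofReal (by positivity) ?_
  refine (measure_mono ?_).trans ((measure_union_le _ _).trans ((add_le_add
    (measure_exists_boundary_le_crossingBound (lam := lam) hmeas hindep hident hmean hσ hL2 hvar
      hε hlam1 hm) hnull.le).trans (le_of_eq (add_zero _))))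
  intro ω hω
  by_contra hcon
  simp only [Set.mem_union, Set.mem_ofPred_eq, not_or, not_exists, not_and, not_le,
    not_forall] at hcon
  obtain ⟨hbelow, M, hM⟩ := hcon
  -- Off both events finitely many ratios are below one and the rest are at most `δ < 1`, so the
  -- supremum stays below one. The `max M 1` excludes `k = 0`, where the boundary vanishes.
  obtain ⟨ρ, hρ, hle⟩ := exists_lt_one_forall_le (m := m) (M := max M 1) hδ
    (r := fun k => |partialSum X k ω / σ| / boundary ε k)
    (fun k hk => (div_lt_one (boundary_pos hε (by omega))).2 (hbelow k hk))
    (fun k hk => (div_le_iff₀ (boundary_pos hε (le_of_max_le_right hk))).2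
      (hM k (le_of_max_le_left hk)).le)
  have hsup : (1 : EReal) ≤ (ρ : EReal) :=
    le_trans hω (iSup₂_le fun k hk => EReal.coe_le_coe_iff.2 (hle k hk))
  exact absurd (EReal.coe_le_coe_iff.1 hsup) (not_le.2 hρ)
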